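/- For $\lambda>0$ and a finite graph $G$, let $\lambda\mathrm{SF}(G)$ be the random spanning forest of $G$ (acyclic subgraph containing all vertices) with $\mathbf P(\lambda\mathrm{SF}(G)=f)\propto \lambda^{|C(f)|}\prod_{c\in C(f)}|c|$, where $C(f)$ is the set of connected components of $f$ and $|c|$ is the number of vertices of $c$. Let $\mathbf K_n$ be the complete graph on $n\ge 1$ vertices with a distinguished vertex $\mathbf o$, and let $\mathrm{Shape}(\lambda\mathrm{SF}(\mathbf K_n),\mathbf o)$ be the connected component of $\mathbf o$ in $\lambda\mathrm{SF}(\mathbf K_n)$, rooted at $\mathbf o$ and considered up to root-preserving isomorphism. For a rooted tree $T$ and $h\in\mathbb N=\{0,1,2,\dots\}$, let $|T|$ be its number of vertices, $T_{\le h}$ its intersection with the closed ball of radius $h$ around the root, $T_h$ and $T_{<h}$ the sets of vertices at distance exactly $h$, respectively less than $h$, from the root, and $\mathrm{Aut}(T)$ the group of its root-preserving graph automorphisms. **Proposition.** Let $h\in\mathbb N$ and let $t$ be a finite unlabeled rooted tree of height $\le h$. (1) For all $\lambda>0$ and all $n\ge |t|$, $$\mathbf P\big(\mathrm{Shape}(\lambda\mathrm{SF}(\mathbf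 K_n),\mathbf o)_{\le h}=t\big)=\frac{1}{|\mathrm{Aut}(t)|}\,\frac{(n-1)!}{(n-|t|)!}\,\frac{1}{(n+\lambda)^{|t|}}\,\big(n|t_h|+\lambda|t|\big)\Big(1-\frac{|t_{<h}|}{n+\lambda}\Big)^{n-|t|-1},$$ and this probability is $0$ for $1\le n<|t|$. (2) Let $(\lambda_n)_{n\ge1}$ be a sequence of positive reals. Then $$\lim_{n\to\infty}\mathbf P\big(\mathrm{Shape}(\lambda_n\mathrm{SF}(\mathbf K_n),\mathbf o)_{\le h}=t\big)=\begin{cases}\dfrac{|t_h|}{|\mathrm{Aut}(t)|}\,e^{-|t_{<h}|}&\text{if }\lambda_n=o(n),\\[2mm] \dfrac{|t_h|+\alpha|t|}{|\mathrm{Aut}(t)|}\,\dfrac{1}{(1+\alpha)^{|t|}}\exp\Big(-\dfrac{|t_{<h}|}{1+\alpha}\Big)&\text{if }\lambda_n\sim\alpha n\text{ for some real }\alpha>0,\\[2mm] \mathbf 1_{\{|t|=1\}}&\text{if }\lambda_n/n\to\infty.\end{cases}$$ -/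

import Mathlib

open Filter Topology Asymptotics

noncomputable section

/-- A graph with a distinguished vertex, its root. -/
structure RootedGraph where
  /-- The vertices. -/
  V : Type
  /-- The edges. -/
  graph : SimpleGraph V
  /-- The distinguished vertex. -/
  root : V

namespace RootedGraph

/-- Isomorphisms of rooted graphs: graph isomorphisms sending root to root. -/
def Iso (S T : RootedGraph) : Type :=
  {φ : S.graph ≃g T.graph // φ S.root = T.root}

/-- `Aut(T)`: the graph automorphisms of `T` that preserve its root. -/
abbrev Aut (T : RootedGraph) : Type := Iso T T

instance isoSetoid : Setoid RootedGraph where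
  r S T := Nonempty (Iso S T)
  iseqv :=
    { refl := fun _ => ⟨⟨SimpleGraph.Iso.refl, rfl⟩⟩
      symm := fun ⟨φ⟩ => ⟨⟨φ.1.symm, φ.1.symm_apply_eq.2 φ.2.symm⟩⟩
      trans := fun ⟨φ⟩ ⟨ψ⟩ =>
        ⟨⟨φ.1.trans ψ.1, (congrArg ψ.1 φ.2).trans ψ.2⟩⟩ }

/-- Unlabeled rooted graphs: rooted graphs up to root-preserving isomorphism. -/
abbrev Unlabeled : Type 1 := Quotient isoSetoid

/-- The unlabeled rooted graph underlying a rooted graph. -/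
def shape (T : RootedGraph) : Unlabeled := Quotient.mk isoSetoid T

/-- `|T|`, the number of vertices. -/
def size (T : RootedGraph) : ℕ := Nat.card T.V

/-- The graph distance to the root (infinite off the component of the root). -/
def depth (T : RootedGraph) (v : T.V) : ℕ∞ := T.graph.edist T.root v

/-- `T` has height at most `h`. -/
def HeightLE (T : RootedGraph) (h : ℕ) : Prop := ∀ v, T.depth v ≤ h

/-- `|T_h|`, the number of vertices at distance exactly `h` from the root. -/
def sizeAt (T : RootedGraph) (h : ℕ) : ℕ := Nat.card {v : T.V // T.depth v = h}

/-- `|T_{<h}|`, the number of vertices at distance less than `h` from the root. -/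
def sizeLT (T : RootedGraph) (h : ℕ) : ℕ := Nat.card {v : T.V // T.depth v < h}

/-- `T_{≤ h}`, the intersection of `T` with the closed ball of radius `h` around its root. -/
def ball (T : RootedGraph) (h : ℕ) : RootedGraph where
  V := {v : T.V | T.depth v ≤ h}
  graph := T.graph.induce {v : T.V | T.depth v ≤ h}
  root := ⟨T.root, by simp [depth]⟩

end RootedGraph

/-- The connected component of `o` in `G`, rooted at `o`. -/
def rootedComponent {V : Type} (G : SimpleGraph V) (o : V) : RootedGraph where
  V := (G.connectedComponentMk o).supp
  graph := G.induce (G.connectedComponentMk o).supp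
  root := ⟨o, SimpleGraph.ConnectedComponent.connectedComponentMk_mem⟩

/-- The spanning forests of `G`: acyclic subgraphs containing all the vertices. -/
def SpanningForest {V : Type} (G : SimpleGraph V) : Type :=
  {F : SimpleGraph V // F ≤ G ∧ F.IsAcyclic}

namespace SpanningForest

variable {V : Type} {G : SimpleGraph V}

instance [Finite V] : Finite (SpanningForest G) :=
  inferInstanceAs (Finite {F : SimpleGraph V // F ≤ G ∧ F.IsAcyclic})

instance : MeasurableSpace (SpanningForest G) := ⊤

/-- The weight `λ ^ |C(F)| * ∏ t ∈ C(F), |t|`, with `C(F)` the set of connected components. -/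
def weight (lam : ℝ) (F : SpanningForest G) : ℝ :=
  lam ^ Nat.card F.1.ConnectedComponent *
    ∏ᶠ c : F.1.ConnectedComponent, (Nat.card c.supp : ℝ)

theorem weight_pos [Finite V] {lam : ℝ} (hlam : 0 < lam) (F : SpanningForest G) :
    0 < weight lam F := by
  refine mul_pos (pow_pos hlam _) (finprod_induction (0 < ·) one_pos (fun _ _ => mul_pos) fun c => ?_)
  have : Nonempty c.supp := c.nonempty_supp.to_subtype
  exact_mod_cast Nat.card_pos

end SpanningForest

/-- The law of the `λ`-massive spanning forest of a finite graph `G`: the probability distribution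
on the spanning forests of `G` that is proportional to the weight. -/
def massiveSpanningForest {V : Type} [Finite V] (G : SimpleGraph V) (lam : ℝ) (hlam : 0 < lam) :
    PMF (SpanningForest G) :=
  PMF.normalize (fun F => ENNReal.ofReal (SpanningForest.weight lam F))
    (by
      have h := SpanningForest.weight_pos hlam
        (⟨⊥, bot_le, SimpleGraph.isAcyclic_bot⟩ : SpanningForest G)
      exact fun h0 => (ENNReal.ofReal_pos.2 h).ne' (ENNReal.tsum_eq_zero.1 h0 _))
    (by
      have := Fintype.ofFinite (SpanningForest G)
      rw [tsum_fintype]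
      exact ENNReal.sum_ne_top.2 fun _ _ => ENNReal.ofReal_ne_top)

/-- The probability that, for the `λ`-massive spanning forest of the complete graph on `n` vertices,
the ball of radius `h` around `o` in the connected component of `o` has the same shape as `t`. -/
def ballShapeProb (n : ℕ) (o : Fin n) (lam : ℝ) (hlam : 0 < lam) (h : ℕ) (t : RootedGraph) : ℝ :=
  (massiveSpanningForest (⊤ : SimpleGraph (Fin n)) lam hlam).toMeasure.real
    {F | ((rootedComponent F.1 o).ball h).shape = t.shape}

end

/-! ### Acyclic graphs: hanging vertices and stars. -/

namespace SimpleGraph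

/-! Reveal the forest vertex by vertex. Let `W(n,k,m)` be the total weight of the completions when
`n` vertices are undiscovered and the current component has `k` discovered vertices, `m` of them
unexplored. Exploring one of these reveals a set of `b` new neighbours, which acyclicity forbids
from being joined to each other or to anything else discovered. Hence `W(n,k,m+1) = ∑_b C(n,b)
W(n-b,k+b,m+b)`. When `m = 0` the component closes, contributes `λk`, and a fresh vertex starts the
next one. The solution is `explorationWeight`: the base `n+m+λ` is common to all terms of the sum,
which leaves a binomial identity (`sum_choose_mul_explorationWeight`, `extensionWeight_eq`).
Starting from nothing yields the normalising constant `λ(n+λ)^(n-1)`.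

The ball event is a union of such states. An embedding of `t` sending its root to `o` is onto the
ball of radius `h` exactly when the forest extends its image and gives no further neighbour to the
vertices of depth `< h`; then `k = |t|` and `m = |t_h|`. A forest with the right ball admits exactly
`|Aut(t)|` such embeddings (`card_isBallEmbedding`), so double counting pairs of a forest and an
embedding gives the probability (`card_aut_mul_sum_weight`).

The asymptotics depend on `λ_n` only through `σ = lim n/(n+λ_n)`, which is `1`, `1/(1+α)` or `0` in
the three regimes (`tendsto_ballShapeProb`). -/

theorem Reachable.exists_adj_right {V : Type*} {G : SimpleGraph V} {u v : V}
    (h : G.Reachable u v) (hne : u ≠ v) : ∃ w, G.Adj v w := by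
  obtain ⟨p⟩ := h.symm
  cases p with
  | nil => exact (hne rfl).elim
  | cons h _ => exact ⟨_, h⟩

/-- A vertex joined to two distinct vertices that are connected without it lies on a cycle. -/
theorem IsAcyclic.eq_of_adj_of_reachable {V : Type*} {F H : SimpleGraph V} (hF : F.IsAcyclic)
    (hle : H ≤ F) {x a y : V} (hr : H.Reachable x a) (hy : ∀ z, ¬ H.Adj y z)
    (ha : F.Adj a y) (hx : F.Adj x y) : x = a := by
  by_contra hne
  refine isAcyclic_iff_forall_adj_isBridge.1 hF ha ?_
  -- Since `y` is isolated in `H`, deleting `ay` keeps the connection from `x` to `a`; the edge `xy`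
  -- also survives, so `ay` is not a bridge.
  have h1 : H ≤ F.deleteEdges {s(a, y)} := by
    intro u v huv
    rw [deleteEdges_adj]
    refine ⟨hle huv, fun h => ?_⟩
    rcases Sym2.eq_iff.1 (Set.mem_singleton_iff.1 h) with ⟨rfl, rfl⟩ | ⟨rfl, rfl⟩
    · exact hy _ huv.symm
    · exact hy _ huv
  refine (hr.mono h1).symm.trans (Adj.reachable ?_)
  rw [deleteEdges_adj]
  refine ⟨hx, fun h => ?_⟩
  rcases Sym2.eq_iff.1 (Set.mem_singleton_iff.1 h) with ⟨rfl, _⟩ | ⟨rfl, h2⟩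
  · exact hne rfl
  · exact hx.ne rfl

theorem IsAcyclic.not_adj_of_adj_of_adj {V : Type*} {F : SimpleGraph V} (hF : F.IsAcyclic)
    {a x y : V} (hx : F.Adj a x) (hy : F.Adj a y) : ¬ F.Adj x y := by
  intro hxy
  have h : x = a := by
    refine hF.eq_of_adj_of_reachable (H := edge x a) ?_ (Adj.reachable ?_) (fun z hz => ?_) hy hxy
    · intro u v huv
      rw [edge_adj] at huv
      rcases huv.1 with ⟨rfl, rfl⟩ | ⟨rfl, rfl⟩
      · exact hx.symm
      · exact hx
    · rw [edge_adj]
      exact ⟨Or.inl ⟨rfl, rfl⟩, hx.ne'⟩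
    · rw [edge_adj] at hz
      rcases hz.1 with ⟨rfl, rfl⟩ | ⟨rfl, rfl⟩
      · exact hxy.ne rfl
      · exact hy.ne rfl
  exact hx.ne' h

/-- Join the vertex `a` to all the vertices of `B`. -/
def addStar {V : Type*} (G : SimpleGraph V) (a : V) (B : Finset V) : SimpleGraph V :=
  G ⊔ fromRel fun x y => x = a ∧ y ∈ B

theorem addStar_adj {V : Type*} {G : SimpleGraph V} {a : V} {B : Finset V} {x y : V} :
    (G.addStar a B).Adj x y ↔ G.Adj x y ∨ x ≠ y ∧ (x = a ∧ y ∈ B ∨ y = a ∧ x ∈ B) := by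
  simp [addStar]

/-- The leaves are attached one at a time; each is isolated until then, so its edge joins two
different components. -/
theorem isAcyclic_addStar {V : Type*} {G : SimpleGraph V} (hG : G.IsAcyclic) {a : V}
    {B : Finset V} (ha : a ∉ B) (hB : ∀ b ∈ B, ∀ z, ¬ G.Adj b z) : (G.addStar a B).IsAcyclic := by
  classical
  induction B using Finset.induction_on with
  | empty =>
    convert hG
    ext x y
    simp [addStar_adj]
  | insert b B hb ih =>
    have hab : a ≠ b := fun h => ha (h ▸ Finset.mem_insert_self _ _)
    have ih' := ih (fun h => ha (Finset.mem_insert_of_mem h))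
      (fun c hc => hB c (Finset.mem_insert_of_mem hc))
    have hn : ¬ (G.addStar a B).Reachable a b := fun h => by
      obtain ⟨w, hw⟩ := h.exists_adj_right hab
      rcases addStar_adj.1 hw with hw | ⟨_, ⟨h1, _⟩ | ⟨_, h1⟩⟩
      · exact hB b (Finset.mem_insert_self _ _) _ hw
      · exact hab h1.symm
      · exact hb h1
    convert ih'.sup_edge_of_not_reachable hn
    ext x y
    simp only [addStar_adj, sup_adj, edge_adj, Finset.mem_insert]
    grind

/-! ### Partially explored forests. -/

/-- The acyclic graphs `F` that agree with `G` on `S` and have no edge from `D` to the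
complement of `S`. -/
structure IsForestExtension {V : Type*} (G : SimpleGraph V) (S D : Finset V) (F : SimpleGraph V) :
    Prop where
  isAcyclic : F.IsAcyclic
  adj_iff : ∀ ⦃x⦄, x ∈ S → ∀ ⦃y⦄, y ∈ S → (F.Adj x y ↔ G.Adj x y)
  not_adj : ∀ ⦃x⦄, x ∈ D → ∀ ⦃y⦄, y ∉ S → ¬ F.Adj x y

/-- The state of an exploration: the vertices of `S` have been discovered, the edges at the
vertices of `D` have been revealed, those of `U` belong to components that have been explored
completely, and `S \ U` is the part of the current component that has been discovered. -/
structure IsExploration {V : Type*} (G : SimpleGraph V) (S D U : Finset V) : Prop where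
  isAcyclic : G.IsAcyclic
  mem_of_adj : ∀ ⦃x y⦄, G.Adj x y → x ∈ S
  subset_left : U ⊆ D
  subset_right : D ⊆ S
  mem_of_mem : ∀ ⦃x⦄, x ∈ U → ∀ ⦃y⦄, G.Adj x y → y ∈ U
  reachable : ∀ ⦃x⦄, x ∈ S → x ∉ U → ∀ ⦃y⦄, y ∈ S → y ∉ U → G.Reachable x y

theorem IsForestExtension.le {V : Type*} {G F : SimpleGraph V} {S D : Finset V}
    (hF : G.IsForestExtension S D F) (hG : ∀ ⦃x y⦄, G.Adj x y → x ∈ S) : G ≤ F :=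
  fun _ _ h => (hF.adj_iff (hG h) (hG h.symm)).2 h

/-- Exploring the vertex `a` and finding its new neighbors to be `B`. -/
theorem isForestExtension_addStar_iff {V : Type*} [DecidableEq V] {G F : SimpleGraph V}
    {S D U : Finset V} (hS : G.IsExploration S D U) {a : V} (haS : a ∈ S) (haD : a ∉ D)
    {B : Finset V} (hB : Disjoint B S) :
    (G.addStar a B).IsForestExtension (S ∪ B) (insert a D) F ↔
      G.IsForestExtension S D F ∧ ∀ b, b ∈ B ↔ b ∉ S ∧ F.Adj a b := by
  have hBS : ∀ b ∈ B, b ∉ S := fun b hb h => Finset.disjoint_left.1 hB hb h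
  constructor
  · intro hF
    refine ⟨⟨hF.isAcyclic, fun x hx y hy => ?_, fun x hx y hy h => ?_⟩, fun b => ⟨fun hb => ?_, ?_⟩⟩
    · rw [hF.adj_iff (Finset.mem_union_left _ hx) (Finset.mem_union_left _ hy), addStar_adj]
      have := hBS x
      have := hBS y
      tauto
    · by_cases hyB : y ∈ B
      · rw [hF.adj_iff (Finset.mem_union_left _ (hS.subset_right hx))
          (Finset.mem_union_right _ hyB), addStar_adj] at h
        rcases h with h | ⟨_, ⟨rfl, _⟩ | ⟨rfl, _⟩⟩
        · exact hy (hS.mem_of_adj h.symm)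
        · exact haD hx
        · exact hy haS
      · exact hF.not_adj (Finset.mem_insert_of_mem hx) (by simp [hy, hyB]) h
    · refine ⟨hBS b hb, ?_⟩
      rw [hF.adj_iff (Finset.mem_union_left _ haS) (Finset.mem_union_right _ hb), addStar_adj]
      exact Or.inr ⟨fun h => hBS b hb (h ▸ haS), Or.inl ⟨rfl, hb⟩⟩
    · rintro ⟨hbS, hab⟩
      by_contra hb
      exact hF.not_adj (Finset.mem_insert_self _ _) (by simp [hbS, hb]) hab
  · rintro ⟨hF, hB'⟩
    have haU : a ∉ U := fun h => haD (hS.subset_left h)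
    -- A second neighbour `x` of `y` in `S` would be unexplored, hence in the current component,
    -- which is connected through `G`; this would close a cycle with `a` and `y`.
    have key : ∀ x ∈ S, ∀ y ∈ B, F.Adj x y ↔ (G.addStar a B).Adj x y := by
      intro x hx y hy
      have hya : F.Adj a y := ((hB' y).1 hy).2
      have hyS := hBS y hy
      rw [addStar_adj]
      constructor
      · intro h
        have hxD : x ∉ D := fun hxD => hF.not_adj hxD hyS h
        have hxU : x ∉ U := fun h => hxD (hS.subset_left h)
        have : x = a := hF.isAcyclic.eq_of_adj_of_reachable (hF.le hS.mem_of_adj)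
          (hS.reachable hx hxU haS haU) (fun z hz => hyS (hS.mem_of_adj hz)) hya h
        exact Or.inr ⟨h.ne, Or.inl ⟨this, hy⟩⟩
      · rintro (h | ⟨_, ⟨rfl, _⟩ | ⟨rfl, _⟩⟩)
        · exact (hyS (hS.mem_of_adj h.symm)).elim
        · exact hya
        · exact (hyS haS).elim
    refine ⟨hF.isAcyclic, fun x hx y hy => ?_, fun x hx y hy => ?_⟩
    · rcases Finset.mem_union.1 hx with hx | hx <;> rcases Finset.mem_union.1 hy with hy | hy
      · rw [hF.adj_iff hx hy, addStar_adj]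
        have := hBS x
        have := hBS y
        tauto
      · exact key x hx y hy
      · rw [adj_comm, key y hy x hx, adj_comm]
      · refine iff_of_false
          (hF.isAcyclic.not_adj_of_adj_of_adj ((hB' x).1 hx).2 ((hB' y).1 hy).2) ?_
        rw [addStar_adj]
        rintro (h | ⟨_, ⟨rfl, _⟩ | ⟨rfl, _⟩⟩)
        · exact hBS x hx (hS.mem_of_adj h)
        · exact hBS _ hx haS
        · exact hBS _ hy haS
    · simp only [Finset.mem_union, not_or] at hy
      rcases Finset.mem_insert.1 hx with rfl | hx
      · exact fun h => hy.2 ((hB' y).2 ⟨hy.1, h⟩)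
      · exact hF.not_adj hx hy.1

theorem IsExploration.addStar {V : Type*} [DecidableEq V] {G : SimpleGraph V}
    {S D U : Finset V} (hS : G.IsExploration S D U) {a : V} (haS : a ∈ S) (haD : a ∉ D)
    {B : Finset V} (hB : Disjoint B S) :
    (G.addStar a B).IsExploration (S ∪ B) (insert a D) U := by
  have hBS : ∀ b ∈ B, b ∉ S := fun b hb h => Finset.disjoint_left.1 hB hb h
  have haU : a ∉ U := fun h => haD (hS.subset_left h)
  have hle : G ≤ G.addStar a B := le_sup_left
  have key : ∀ x ∈ S ∪ B, x ∉ U → (G.addStar a B).Reachable x a := by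
    intro x hx hxU
    rcases Finset.mem_union.1 hx with hx | hx
    · exact (hS.reachable hx hxU haS haU).mono hle
    · exact Adj.reachable (addStar_adj.2 (Or.inr ⟨fun h => hBS x hx (h ▸ haS), Or.inr ⟨rfl, hx⟩⟩))
  refine ⟨isAcyclic_addStar hS.isAcyclic (fun h => hBS a h haS)
    (fun b hb z hz => hBS b hb (hS.mem_of_adj hz)), fun x y h => ?_,
    hS.subset_left.trans (Finset.subset_insert _ _), ?_, fun x hx y h => ?_,
    fun x hx hxU y hy hyU => (key x hx hxU).trans (key y hy hyU).symm⟩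
  · rcases addStar_adj.1 h with h | ⟨_, ⟨rfl, _⟩ | ⟨_, h⟩⟩
    · exact Finset.mem_union_left _ (hS.mem_of_adj h)
    · exact Finset.mem_union_left _ haS
    · exact Finset.mem_union_right _ h
  · exact Finset.insert_subset (Finset.mem_union_left _ haS)
      (hS.subset_right.trans Finset.subset_union_left)
  · rcases addStar_adj.1 h with h | ⟨_, ⟨rfl, _⟩ | ⟨_, h⟩⟩
    · exact hS.mem_of_mem hx h
    · exact (haU hx).elim
    · exact (hBS x h (hS.subset_right (hS.subset_left hx))).elim

/-- When the current component has been explored, it is declared complete. -/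
theorem IsExploration.close {V : Type*} {G : SimpleGraph V}
    {S U : Finset V} (hS : G.IsExploration S S U) : G.IsExploration S S S :=
  ⟨hS.isAcyclic, hS.mem_of_adj, subset_rfl, subset_rfl, fun _ _ _ h => hS.mem_of_adj h.symm,
    fun _ h h' => (h' h).elim⟩

/-- When there is no current component, any new vertex starts one. -/
theorem IsExploration.start {V : Type*} [DecidableEq V] {G : SimpleGraph V}
    {U : Finset V} (hU : G.IsExploration U U U) (a : V) :
    G.IsExploration (insert a U) U U := by
  refine ⟨hU.isAcyclic, fun x y h => Finset.mem_insert_of_mem (hU.mem_of_adj h), subset_rfl,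
    Finset.subset_insert _ _, hU.mem_of_mem, fun x hx hxU y hy hyU => ?_⟩
  obtain rfl := (Finset.mem_insert.1 hx).resolve_right hxU
  obtain rfl := (Finset.mem_insert.1 hy).resolve_right hyU
  exact Reachable.refl _

/-- All edges at `U` are already known and none reaches `a`, so declaring `a` discovered imposes
nothing on `F`. -/
theorem isForestExtension_insert_iff {V : Type*} [DecidableEq V] {G F : SimpleGraph V}
    {U : Finset V} (hU : G.IsExploration U U U) {a : V} (ha : a ∉ U) :
    G.IsForestExtension (insert a U) U F ↔ G.IsForestExtension U U F := by
  constructor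
  · intro hF
    refine ⟨hF.isAcyclic, fun x hx y hy =>
      hF.adj_iff (Finset.mem_insert_of_mem hx) (Finset.mem_insert_of_mem hy), fun x hx y hy h => ?_⟩
    by_cases hya : y = a
    · subst hya
      rw [hF.adj_iff (Finset.mem_insert_of_mem hx) (Finset.mem_insert_self _ _)] at h
      exact hy (hU.mem_of_adj h.symm)
    · exact hF.not_adj hx (by simp [hya, hy]) h
  · intro hF
    refine ⟨hF.isAcyclic, fun x hx y hy => ?_, fun x hx y hy =>
      hF.not_adj hx fun h => hy (Finset.mem_insert_of_mem h)⟩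
    have key : ∀ z ∈ U, ¬ F.Adj z a ∧ ¬ G.Adj z a := fun z hz =>
      ⟨hF.not_adj hz ha, fun h => ha (hU.mem_of_adj h.symm)⟩
    rcases Finset.mem_insert.1 hx with h1 | h1 <;> rcases Finset.mem_insert.1 hy with h2 | h2
    · simp [h1, h2]
    · rw [h1, adj_comm, adj_comm G]
      exact iff_of_false (key y h2).1 (key y h2).2
    · rw [h2]
      exact iff_of_false (key x h1).1 (key x h1).2
    · exact hF.adj_iff h1 h2

/-- The number of vertices of the component of `v`. -/
noncomputable def componentSize {V : Type*} (F : SimpleGraph V) (v : V) : ℕ :=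
  Nat.card (F.connectedComponentMk v).supp

/-- With every discovered vertex explored, no edge leaves `S`, and none joins `S \ U` to the closed
part `U`; so the connected set `S \ U` is a whole component of `F`. -/
theorem componentSize_eq_of_isForestExtension {V : Type*} [DecidableEq V] {G F : SimpleGraph V}
    {S U : Finset V} (hS : G.IsExploration S S U) (hF : G.IsForestExtension S S F) {v : V}
    (hv : v ∈ S \ U) : F.componentSize v = (S \ U).card := by
  rw [Finset.mem_sdiff] at hv
  have hle := hF.le hS.mem_of_adj
  have key : ∀ w, F.Reachable v w → w ∈ S \ U := by
    intro w hw
    rw [reachable_iff_reflTransGen] at hw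
    induction hw with
    | refl => exact Finset.mem_sdiff.2 hv
    | @tail b c _ hbc ih =>
      rw [Finset.mem_sdiff] at ih ⊢
      have hc : c ∈ S := by
        by_contra hc
        exact hF.not_adj ih.1 hc hbc
      refine ⟨hc, fun hcU => ih.2 (hS.mem_of_mem hcU ?_)⟩
      rw [adj_comm]
      exact (hF.adj_iff ih.1 hc).1 hbc
  have : (F.connectedComponentMk v).supp = ((S \ U : Finset V) : Set V) := by
    ext w
    rw [ConnectedComponent.mem_supp_iff, ConnectedComponent.eq, Finset.mem_coe]
    refine ⟨fun h => key w h.symm, fun h => ?_⟩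
    rw [Finset.mem_sdiff] at h
    exact (hS.reachable h.1 h.2 hv.1 hv.2).mono hle
  rw [componentSize, this, Nat.card_coe_set_eq, Set.ncard_coe_finset]

end SimpleGraph

/-! ### The recursion for the weight of the completions. -/

/-- The total weight of the completions of a partially explored forest, when `n` vertices are
undiscovered, `k` vertices of the current component have been discovered, and `m` of these have
not been explored. -/
noncomputable def explorationWeight (lam : ℝ) (n k m : ℕ) : ℝ :=
  lam * ((n + k) * m + lam * k) * (n + m + lam) ^ ((n : ℤ) - 1)

/-- Absorb `b` by `b C(n,b) = n C(n-1,b-1)`. At `n = 0` the truncated exponent is harmless because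
of the factor `n`. -/
theorem sum_choose_mul_natCast_mul_pow (n : ℕ) (x : ℝ) :
    ∑ b ∈ Finset.range (n + 1), (n.choose b : ℝ) * b * x ^ (n - b) = n * (1 + x) ^ (n - 1) := by
  cases n with
  | zero => simp
  | succ n =>
    rw [Finset.sum_range_succ']
    simp only [Nat.cast_zero, mul_zero, zero_mul, add_zero, Nat.add_sub_add_right,
      Nat.add_sub_cancel]
    rw [add_pow, Finset.mul_sum]
    refine Finset.sum_congr rfl fun b _ => ?_
    have h : ((n + 1 : ℕ) : ℝ) * n.choose b = (n + 1).choose (b + 1) * (b + 1 : ℕ) := by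
      exact_mod_cast Nat.add_one_mul_choose_eq n b
    rw [← h, one_pow]
    ring

/-- The base `x = n+m+λ` does not depend on `b`, and the remaining factor is affine in `b`; the
binomial theorem and its version weighted by `b` sum the two parts. -/
theorem sum_choose_mul_explorationWeight {lam : ℝ} (hlam : 0 < lam) (n k m : ℕ) :
    ∑ b ∈ Finset.range (n + 1), (n.choose b : ℝ) * explorationWeight lam (n - b) (k + b) (m + b) =
      explorationWeight lam n k (m + 1) := by
  set x : ℝ := n + m + lam with hx
  have hx0 : 0 < x := by positivity
  have h1 : ∀ b ∈ Finset.range (n + 1),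
      (n.choose b : ℝ) * explorationWeight lam (n - b) (k + b) (m + b) =
        lam / x * ((((n + k) * m + lam * k)) * (1 ^ b * x ^ (n - b) * n.choose b) +
          (n + k + lam) * ((n.choose b : ℝ) * b * x ^ (n - b))) := by
    intro b hb
    have hb' : b ≤ n := Nat.lt_succ_iff.1 (Finset.mem_range.1 hb)
    have e : ((n - b : ℕ) : ℝ) + (m + b : ℕ) + lam = x := by
      rw [Nat.cast_sub hb', hx]; push_cast; ring
    rw [explorationWeight, e, zpow_sub_one₀ hx0.ne', zpow_natCast, Nat.cast_sub hb']
    push_cast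
    field_simp
    ring
  rw [Finset.sum_congr rfl h1, ← Finset.mul_sum, Finset.sum_add_distrib, ← Finset.mul_sum,
    ← Finset.mul_sum, ← add_pow, sum_choose_mul_natCast_mul_pow, explorationWeight]
  have e : (n : ℝ) + (m + 1 : ℕ) + lam = 1 + x := by rw [hx]; push_cast; ring
  have h0 : (1 : ℝ) + x ≠ 0 := by positivity
  rw [e, zpow_sub_one₀ h0, zpow_natCast]
  rcases Nat.eq_zero_or_pos n with rfl | hn
  · simp only [hx] at *
    field_simp
    push_cast
    ring
  · obtain ⟨n, rfl⟩ := Nat.exists_eq_add_of_lt hn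
    simp only [zero_add, Nat.add_sub_cancel, pow_succ]
    field_simp
    rw [hx]
    push_cast
    ring

/-! ### Total weight of the forests extending an exploration. -/

/-- The weight of a vertex in a component of size `s`, so that the product over the component
is `lam * s`. -/
noncomputable def vertexWeight (lam : ℝ) (s : ℕ) : ℝ := (lam * s) ^ (s : ℝ)⁻¹

theorem vertexWeight_pow {lam : ℝ} (hlam : 0 < lam) {s : ℕ} (hs : s ≠ 0) :
    vertexWeight lam s ^ s = lam * s :=
  Real.rpow_inv_natCast_pow (by positivity) hs

open scoped Classical in
/-- The total weight outside `U` of the forests that extend a partially explored one. -/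
noncomputable def extensionWeight {V : Type*} [Fintype V] [DecidableEq V] (lam : ℝ) (G : SimpleGraph V)
    (S D U : Finset V) : ℝ :=
  ∑ F : SimpleGraph V with G.IsForestExtension S D F,
    ∏ v ∈ Uᶜ, vertexWeight lam (F.componentSize v)

namespace SimpleGraph.IsExploration

variable {V : Type*} [Fintype V] [DecidableEq V] {lam : ℝ} {G : SimpleGraph V} {S D U : Finset V}

/-- The extensions are partitioned by the set `B` of undiscovered neighbours of `a`. -/
theorem extensionWeight_eq_sum (hS : G.IsExploration S D U) {a : V} (haS : a ∈ S) (haD : a ∉ D) :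
    extensionWeight lam G S D U =
      ∑ B ∈ Sᶜ.powerset, extensionWeight lam (G.addStar a B) (S ∪ B) (insert a D) U := by
  classical
  unfold extensionWeight
  refine (Finset.sum_fiberwise_of_maps_to (t := Sᶜ.powerset)
    (g := fun F : SimpleGraph V => Finset.univ.filter fun b => b ∉ S ∧ F.Adj a b) ?_ _).symm.trans ?_
  rotate_left
  · refine Finset.sum_congr rfl fun B hB => Finset.sum_congr ?_ fun _ _ => rfl
    have hB' : Disjoint B S := by
      rw [Finset.mem_powerset] at hB
      exact Finset.disjoint_left.2 fun b hb hbS => Finset.mem_compl.1 (hB hb) hbS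
    ext F
    simp only [Finset.mem_filter, Finset.mem_univ, true_and]
    rw [isForestExtension_addStar_iff hS haS haD hB', Finset.ext_iff]
    refine and_congr_right fun _ => forall_congr' fun b => ?_
    simp only [Finset.mem_filter, Finset.mem_univ, true_and]
    exact iff_comm
  · intro F _
    rw [Finset.mem_powerset]
    intro b hb
    simp only [Finset.mem_filter, Finset.mem_univ, true_and] at hb
    exact Finset.mem_compl.2 hb.1

theorem extensionWeight_close (hlam : 0 < lam) (hS : G.IsExploration S S U)
    (hne : (S \ U).Nonempty) :
    extensionWeight lam G S S U = lam * (S \ U).card * extensionWeight lam G S S S := by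
  classical
  unfold extensionWeight
  rw [Finset.mul_sum]
  refine Finset.sum_congr rfl fun F hF => ?_
  have hF' := (Finset.mem_filter.1 hF).2
  have hU : U ⊆ S := hS.subset_left
  have e : Uᶜ = (S \ U) ∪ Sᶜ := by
    ext v
    simp only [Finset.mem_compl, Finset.mem_union, Finset.mem_sdiff]
    have := @hU v
    tauto
  have hd : Disjoint (S \ U) Sᶜ :=
    Finset.disjoint_left.2 fun v hv h => Finset.mem_compl.1 h (Finset.mem_sdiff.1 hv).1
  have hp : ∏ v ∈ S \ U, vertexWeight lam (F.componentSize v) = lam * (S \ U).card := by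
    rw [Finset.prod_congr rfl fun v hv => by rw [componentSize_eq_of_isForestExtension hS hF' hv],
      Finset.prod_const, vertexWeight_pow hlam hne.card_ne_zero]
  rw [e, Finset.prod_union hd, hp]

theorem extensionWeight_insert (hU : G.IsExploration U U U) {a : V} (ha : a ∉ U) :
    extensionWeight lam G U U U = extensionWeight lam G (insert a U) U U := by
  classical
  unfold extensionWeight
  refine Finset.sum_congr ?_ fun _ _ => rfl
  ext F
  simp only [Finset.mem_filter, Finset.mem_univ, true_and]
  exact (isForestExtension_insert_iff hU ha).symm

theorem extensionWeight_univ (hU : G.IsExploration Finset.univ Finset.univ Finset.univ) :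
    extensionWeight lam G Finset.univ Finset.univ Finset.univ = 1 := by
  classical
  unfold extensionWeight
  have : (Finset.univ.filter fun F : SimpleGraph V =>
      G.IsForestExtension Finset.univ Finset.univ F) = {G} := by
    ext F
    simp only [Finset.mem_filter, Finset.mem_univ, true_and, Finset.mem_singleton]
    constructor
    · intro h
      ext x y
      exact h.adj_iff (Finset.mem_univ _) (Finset.mem_univ _)
    · rintro rfl
      exact ⟨hU.isAcyclic, fun _ _ _ _ => Iff.rfl, fun _ _ y hy => (hy (Finset.mem_univ y)).elim⟩
  simp [this]

/-- The value after starting a new component is taken as a hypothesis, so that this can serve inside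
the induction of `extensionWeight_eq` as well as after it. -/
theorem extensionWeight_eq_of_closed_of_forall (hlam : 0 < lam) (hU : G.IsExploration U U U)
    (h : ∀ a ∉ U, extensionWeight lam G (insert a U) U U =
      explorationWeight lam (insert a U)ᶜ.card 1 1) :
    extensionWeight lam G U U U = lam * (Uᶜ.card + lam) ^ ((Uᶜ.card : ℤ) - 1) := by
  by_cases hne : Uᶜ.Nonempty
  · obtain ⟨a, ha⟩ := hne
    have ha' := Finset.mem_compl.1 ha
    rw [extensionWeight_insert hU ha', h a ha', Finset.compl_insert, explorationWeight]
    have hc : (((Uᶜ.erase a).card : ℕ) : ℝ) = Uᶜ.card - 1 := by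
      rw [Finset.card_erase_of_mem ha, Nat.cast_pred (Finset.card_pos.2 ⟨a, ha⟩)]
    have hz : (((Uᶜ.erase a).card : ℕ) : ℤ) = Uᶜ.card - 1 := by
      rw [Finset.card_erase_of_mem ha, Nat.cast_pred (Finset.card_pos.2 ⟨a, ha⟩)]
    have h0 : (Uᶜ.card : ℝ) + lam ≠ 0 := by positivity
    have e : (Uᶜ.card : ℝ) - 1 + (1 : ℕ) + lam = Uᶜ.card + lam := by push_cast; ring
    rw [hc, hz, e, zpow_sub_one₀ h0 ((Uᶜ.card : ℤ) - 1)]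
    push_cast
    field_simp
    ring
  -- With no vertex left the exponent is `-1`, and the value is `λ * λ⁻¹ = 1`.
  · rw [Finset.not_nonempty_iff_eq_empty, Finset.compl_eq_empty_iff] at hne
    subst hne
    rw [extensionWeight_univ hU]
    simp [hlam.ne']

theorem extensionWeight_eq (hlam : 0 < lam) (hS : G.IsExploration S D U) (hne : (S \ U).Nonempty) :
    extensionWeight lam G S D U =
      explorationWeight lam Sᶜ.card (S \ U).card (S \ D).card := by
  induction hd : Dᶜ.card using Nat.strong_induction_on generalizing G S D U with
  | _ d ih =>
  -- Closing a component and starting another leaves `D` unchanged, so the induction hypothesis does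
  -- not cover that case. Proving the exploration step for all `G`, `S`, `U` with this `D` does.
  have step : ∀ {G : SimpleGraph V} {S U : Finset V}, G.IsExploration S D U → (S \ D).Nonempty →
      extensionWeight lam G S D U =
        explorationWeight lam Sᶜ.card (S \ U).card (S \ D).card := by
    intro G S U hS hne
    obtain ⟨a, ha⟩ := hne
    obtain ⟨haS, haD⟩ := Finset.mem_sdiff.1 ha
    have haU : a ∉ U := fun h => haD (hS.subset_left h)
    obtain ⟨m, hm⟩ : ∃ m, (S \ D).card = m + 1 :=
      Nat.exists_eq_add_of_lt (Finset.card_pos.2 ⟨a, ha⟩) |>.imp fun m h => by simpa using h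
    rw [hS.extensionWeight_eq_sum haS haD, hm, ← sum_choose_mul_explorationWeight hlam]
    have h1 : ∀ B ∈ Sᶜ.powerset,
        extensionWeight lam (G.addStar a B) (S ∪ B) (insert a D) U =
          explorationWeight lam (Sᶜ.card - B.card) ((S \ U).card + B.card) (m + B.card) := by
      intro B hB
      rw [Finset.mem_powerset] at hB
      have hBS : Disjoint B S :=
        Finset.disjoint_left.2 fun b hb hbS => Finset.mem_compl.1 (hB hb) hbS
      have hBS' : ∀ b ∈ B, b ∉ S := fun b hb => Finset.mem_compl.1 (hB hb)
      rw [ih (insert a D)ᶜ.card ?_ (hS.addStar haS haD hBS) ⟨a, by simp [haS, haU]⟩ rfl]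
      · congr 1
        · rw [Finset.compl_union, ← Finset.sdiff_eq_inter_compl, Finset.card_sdiff_of_subset hB]
        · rw [← Finset.card_union_of_disjoint (hBS.symm.mono_left Finset.sdiff_subset)]
          congr 1
          ext x
          have := hBS' x
          have := fun h => hS.subset_right (@hS.subset_left x h)
          simp only [Finset.mem_sdiff, Finset.mem_union]
          tauto
        · have e : (S ∪ B) \ insert a D = (S \ D).erase a ∪ B := by
            ext x
            have := hBS' x
            have := @hS.subset_right x
            have : x = a → x ∈ S := fun h => h ▸ haS
            simp only [Finset.mem_sdiff, Finset.mem_union, Finset.mem_insert, Finset.mem_erase]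
            tauto
          rw [e, Finset.card_union_of_disjoint, Finset.card_erase_of_mem ha, hm,
            Nat.add_sub_cancel]
          exact hBS.symm.mono_left ((Finset.erase_subset _ _).trans Finset.sdiff_subset)
      · rw [← hd, Finset.compl_insert]
        exact Finset.card_erase_lt_of_mem (Finset.mem_compl.2 haD)
    rw [Finset.sum_congr rfl h1, Finset.sum_powerset_apply_card
      (fun b => explorationWeight lam (Sᶜ.card - b) ((S \ U).card + b) (m + b))]
    simp only [nsmul_eq_mul]
  by_cases hSD : (S \ D).Nonempty
  · exact step hS hSD
  · have hDS : D = S := by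
      rw [Finset.not_nonempty_iff_eq_empty, Finset.sdiff_eq_empty_iff_subset] at hSD
      exact hS.subset_right.antisymm hSD
    subst hDS
    rw [hS.extensionWeight_close hlam hne, extensionWeight_eq_of_closed_of_forall hlam hS.close]
    · simp only [explorationWeight, sdiff_self, Finset.bot_eq_empty, Finset.card_empty,
        Nat.cast_zero, mul_zero, zero_add, add_zero]
      ring
    · intro a ha
      have e : insert a D \ D = {a} := by
        ext x
        simp only [Finset.mem_sdiff, Finset.mem_insert, Finset.mem_singleton]
        have : x = a → x ∉ D := fun h => h ▸ ha
        tauto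
      rw [step (hS.close.start a) (by simp [e]), e, Finset.card_singleton]

/-- The total weight of the forests that extend a completely explored one. -/
theorem extensionWeight_eq_of_closed (hlam : 0 < lam) (hU : G.IsExploration U U U) :
    extensionWeight lam G U U U = lam * (Uᶜ.card + lam) ^ ((Uᶜ.card : ℤ) - 1) := by
  refine extensionWeight_eq_of_closed_of_forall hlam hU fun a ha => ?_
  have e : insert a U \ U = {a} := by
    ext x
    simp only [Finset.mem_sdiff, Finset.mem_insert, Finset.mem_singleton]
    have : x = a → x ∉ U := fun h => h ▸ ha
    tauto
  rw [(hU.start a).extensionWeight_eq hlam (by simp [e]), e, Finset.card_singleton]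

end SimpleGraph.IsExploration

/-! ### Balls described by embeddings of `t`. -/

theorem SimpleGraph.edist_map_le {V W : Type*} {G : SimpleGraph V} {H : SimpleGraph W}
    (f : G →g H) (u v : V) : H.edist (f u) (f v) ≤ G.edist u v := by
  by_cases h : G.edist u v = ⊤
  · simp [h]
  · obtain ⟨p, hp⟩ := exists_walk_of_edist_ne_top h
    rw [← hp, ← Walk.length_map f p]
    exact edist_le _

namespace RootedGraph

/-- The embeddings of `S` into `T` that are isomorphisms onto the ball of radius `h`, when `S` is
connected and of height at most `h`. -/
structure IsBallEmbedding (S T : RootedGraph) (h : ℕ) (ψ : S.V ↪ T.V) : Prop where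
  map_root : ψ S.root = T.root
  adj_iff : ∀ x y, T.graph.Adj (ψ x) (ψ y) ↔ S.graph.Adj x y
  mem_range : ∀ x, S.depth x < h → ∀ w, T.graph.Adj (ψ x) w → w ∈ Set.range ψ

theorem depth_le_of_adj (T : RootedGraph) {v w : T.V} (h : T.graph.Adj v w) :
    T.depth w ≤ T.depth v + 1 :=
  SimpleGraph.edist_triangle.trans (add_le_add_right (SimpleGraph.edist_eq_one_iff_adj.2 h).le _)

namespace IsBallEmbedding

variable {S T : RootedGraph} {h : ℕ} {ψ : S.V ↪ T.V}

theorem depth_le (hψ : S.IsBallEmbedding T h ψ) (x : S.V) : T.depth (ψ x) ≤ S.depth x := by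
  unfold depth
  rw [← hψ.map_root]
  exact SimpleGraph.edist_map_le (⟨ψ, fun hxy => (hψ.adj_iff _ _).2 hxy⟩ : S.graph →g T.graph) _ _

/-- This is surjectivity onto the ball. The walk is lifted starting from the root; before each step
the lifted vertex has depth `< h`, so its neighbours are in the range. -/
theorem exists_eq_of_walk (hψ : S.IsBallEmbedding T h ψ) {v : T.V}
    (p : T.graph.Walk v T.root) (hp : p.length ≤ h) : ∃ x, ψ x = v ∧ S.depth x ≤ p.length := by
  suffices ∀ {v r : T.V} (p : T.graph.Walk v r), r = T.root → p.length ≤ h →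
      ∃ x, ψ x = v ∧ S.depth x ≤ p.length from this p rfl hp
  intro v r p hr hp
  induction p with
  | nil => exact ⟨S.root, hψ.map_root.trans hr.symm, by simp [depth]⟩
  | cons hadj q ih =>
    rw [SimpleGraph.Walk.length_cons] at hp ⊢
    obtain ⟨x, rfl, hx⟩ := ih hr (by omega)
    have hlt : S.depth x < h := hx.trans_lt (by exact_mod_cast (by omega : q.length < h))
    obtain ⟨y, rfl⟩ := hψ.mem_range x hlt _ hadj.symm
    refine ⟨y, rfl, ?_⟩
    rw [hψ.adj_iff] at hadj
    push_cast
    exact (S.depth_le_of_adj hadj.symm).trans (add_le_add_left hx 1)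

end IsBallEmbedding

/-- The embedding underlying an isomorphism onto a ball. -/
def Iso.ballEmbedding {S T : RootedGraph} {h : ℕ} (φ : Iso S (T.ball h)) : S.V ↪ T.V :=
  φ.1.toEquiv.toEmbedding.trans (Function.Embedding.subtype _)

theorem Iso.isBallEmbedding {S T : RootedGraph} {h : ℕ} (φ : Iso S (T.ball h)) :
    S.IsBallEmbedding T h φ.ballEmbedding where
  map_root := congrArg Subtype.val φ.2
  adj_iff x y := φ.1.map_adj_iff
  mem_range x hx w hw := by
    have h1 : T.depth (φ.ballEmbedding x) ≤ S.depth x := by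
      have h2 : φ.ballEmbedding S.root = T.root := congrArg Subtype.val φ.2
      unfold depth
      rw [← h2]
      exact SimpleGraph.edist_map_le
        (⟨φ.ballEmbedding, fun hxy => φ.1.map_adj_iff.2 hxy⟩ : S.graph →g T.graph) _ _
    have h3 : T.depth w ≤ h :=
      (T.depth_le_of_adj hw).trans (Order.add_one_le_of_lt (h1.trans_lt hx))
    exact ⟨φ.1.symm ⟨w, h3⟩, congrArg Subtype.val (φ.1.apply_symm_apply ⟨w, h3⟩)⟩

theorem card_iso_ball {S T : RootedGraph} {h : ℕ} (hS : S.HeightLE h) :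
    Nat.card (Iso S (T.ball h)) = Nat.card {ψ : S.V ↪ T.V // S.IsBallEmbedding T h ψ} := by
  refine Nat.card_congr (Equiv.ofBijective (fun φ => ⟨φ.ballEmbedding, φ.isBallEmbedding⟩)
    ⟨fun φ φ' hφ => ?_, fun ⟨ψ, hψ⟩ => ?_⟩)
  · refine Subtype.ext (RelIso.ext fun x => Subtype.ext ?_)
    exact DFunLike.congr_fun (congrArg Subtype.val hφ) x
  · have hmem : ∀ x, T.depth (ψ x) ≤ h := fun x => (hψ.depth_le x).trans (hS x)
    let e : S.V ≃ (T.ball h).V := Equiv.ofBijective (fun x => ⟨ψ x, hmem x⟩)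
      ⟨fun x y hxy => ψ.injective (congrArg Subtype.val hxy), fun ⟨v, hv⟩ => by
        have hv' : T.graph.edist T.root v ≤ h := hv
        have hne : T.graph.edist T.root v ≠ ⊤ := ne_top_of_le_ne_top (ENat.natCast_ne_top h) hv'
        obtain ⟨p, hp⟩ := SimpleGraph.exists_walk_of_edist_ne_top hne
        rw [← hp] at hv'
        obtain ⟨x, hx, _⟩ := hψ.exists_eq_of_walk p.reverse
          (by rw [SimpleGraph.Walk.length_reverse]; exact_mod_cast hv')
        exact ⟨x, Subtype.ext hx⟩⟩
    exact ⟨⟨⟨e, hψ.adj_iff _ _⟩, Subtype.ext hψ.map_root⟩, rfl⟩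

/-- A connected `S` containing a preimage of `o` stays in the component of `o`, so the component can
be replaced by the whole forest. -/
theorem card_isBallEmbedding_rootedComponent {V : Type} {F : SimpleGraph V} {o : V}
    {S : RootedGraph} {h : ℕ} (hS : S.graph.Connected) :
    Nat.card {ψ : S.V ↪ (rootedComponent F o).V // S.IsBallEmbedding (rootedComponent F o) h ψ} =
      Nat.card {ψ : S.V ↪ V // S.IsBallEmbedding ⟨V, F, o⟩ h ψ} := by
  let ι : (rootedComponent F o).V ↪ V := Function.Embedding.subtype _
  have hι : ∀ v w, F.Adj (ι v) w → ∃ w' : (rootedComponent F o).V, ι w' = w := by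
    intro v w hvw
    refine ⟨⟨w, ?_⟩, rfl⟩
    have hv := v.2
    rw [SimpleGraph.ConnectedComponent.mem_supp_iff] at hv ⊢
    rw [← hv, SimpleGraph.ConnectedComponent.eq]
    exact hvw.reachable.symm
  refine Nat.card_congr (Equiv.ofBijective (fun ψ => ⟨ψ.1.trans ι, ?_, ?_, ?_⟩)
    ⟨fun ψ ψ' hψ => ?_, fun ⟨ψ, hψ⟩ => ?_⟩)
  · exact congrArg Subtype.val ψ.2.map_root
  · exact ψ.2.adj_iff
  · intro x hx w hw
    obtain ⟨w, rfl⟩ := hι _ _ hw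
    obtain ⟨y, rfl⟩ := ψ.2.mem_range x hx w hw
    exact ⟨y, rfl⟩
  · refine Subtype.ext (DFunLike.ext _ _ fun x => ι.injective ?_)
    exact DFunLike.congr_fun (congrArg Subtype.val hψ) x
  · have hmem : ∀ x, ψ x ∈ (F.connectedComponentMk o).supp := by
      intro x
      have h1 : F.Reachable (ψ x) (ψ S.root) := (hS x S.root).map
        (⟨ψ, fun hxy => (hψ.adj_iff _ _).2 hxy⟩ : S.graph →g F)
      rw [SimpleGraph.ConnectedComponent.mem_supp_iff, SimpleGraph.ConnectedComponent.eq]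
      exact h1.trans (hψ.map_root ▸ SimpleGraph.Reachable.refl _)
    refine ⟨⟨⟨fun x => ⟨ψ x, hmem x⟩, fun x y hxy => ψ.injective (congrArg Subtype.val hxy)⟩,
      Subtype.ext hψ.map_root, hψ.adj_iff, fun x hx w hw => ?_⟩, rfl⟩
    obtain ⟨y, hy⟩ := hψ.mem_range x hx w.1 hw
    exact ⟨y, Subtype.ext hy⟩

/-- Composition with an isomorphism identifies the isomorphisms with the automorphisms. -/
def Iso.equivAut {S T : RootedGraph} (φ : Iso S T) : Iso S T ≃ S.Aut where
  toFun χ := ⟨χ.1.trans φ.1.symm, (congrArg φ.1.symm χ.2).trans (φ.1.symm_apply_eq.2 φ.2.symm)⟩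
  invFun σ := ⟨σ.1.trans φ.1, (congrArg φ.1 σ.2).trans φ.2⟩
  left_inv χ := Subtype.ext (RelIso.ext fun x => φ.1.apply_symm_apply (χ.1 x))
  right_inv σ := Subtype.ext (RelIso.ext fun x => φ.1.symm_apply_apply (σ.1 x))

open Classical in
theorem card_iso (S T : RootedGraph) :
    Nat.card (Iso S T) = if T.shape = S.shape then Nat.card S.Aut else 0 := by
  split_ifs with h
  · obtain ⟨φ⟩ : Nonempty (Iso S T) := Quotient.exact h.symm
    exact Nat.card_congr φ.equivAut
  · have : IsEmpty (Iso S T) := ⟨fun φ => h (Quotient.sound ⟨φ⟩ : S.shape = T.shape).symm⟩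
    exact Nat.card_of_isEmpty

open Classical in
-- The isomorphisms from `t` onto the ball, if there are any, are in bijection with `Aut(t)`. This
-- turns the event into a count of embeddings.
theorem card_isBallEmbedding {V : Type} (F : SimpleGraph V) (o : V) {t : RootedGraph} {h : ℕ}
    (ht : t.graph.Connected) (hheight : t.HeightLE h) :
    Nat.card {ψ : t.V ↪ V // t.IsBallEmbedding ⟨V, F, o⟩ h ψ} =
      if ((rootedComponent F o).ball h).shape = t.shape then Nat.card t.Aut else 0 := by
  rw [← card_isBallEmbedding_rootedComponent ht, ← card_iso_ball hheight, card_iso]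

end RootedGraph

/-! ### The image of `t` as a state of the exploration. -/

/-- Walks in the image lift through `ψ`, so an edge of the image that is not a bridge would come
from one in `G`. -/
theorem SimpleGraph.isAcyclic_map {V W : Type*} {G : SimpleGraph V} (hG : G.IsAcyclic)
    (ψ : V ↪ W) : (G.map ψ).IsAcyclic := by
  have key : ∀ {H : SimpleGraph V} {x : V} {w : W}, (H.map ψ).Reachable (ψ x) w →
      ∃ y, ψ y = w ∧ H.Reachable x y := by
    intro H x w hw
    rw [reachable_iff_reflTransGen] at hw
    induction hw with
    | refl => exact ⟨x, rfl, Reachable.refl _⟩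
    | @tail b c _ hbc ih =>
      obtain ⟨y, rfl, hy⟩ := ih
      obtain ⟨-, y', z, hyz, h1, rfl⟩ := hbc
      rw [ψ.injective h1] at hyz
      exact ⟨z, rfl, hy.trans hyz.reachable⟩
  rw [isAcyclic_iff_forall_adj_isBridge]
  rintro _ _ ⟨-, x, y, hxy, rfl, rfl⟩
  rw [isBridge_iff]
  intro hr
  have hle : (G.map ψ).deleteEdges {s(ψ x, ψ y)} ≤ (G.deleteEdges {s(x, y)}).map ψ := by
    intro u v huv
    rw [deleteEdges_adj] at huv
    obtain ⟨⟨hab', a, b, hab, rfl, rfl⟩, hne⟩ := huv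
    refine ⟨hab', a, b, ?_, rfl, rfl⟩
    rw [deleteEdges_adj]
    refine ⟨hab, fun h => hne ?_⟩
    rcases Sym2.eq_iff.1 (Set.mem_singleton_iff.1 h) with ⟨rfl, rfl⟩ | ⟨rfl, rfl⟩
    · rfl
    · exact Sym2.eq_swap
  obtain ⟨z, hz, hxz⟩ := key (hr.mono hle)
  rw [ψ.injective hz] at hxz
  exact isAcyclic_iff_forall_adj_isBridge.1 hG hxy hxz

open scoped Classical in
/-- The embeddings of `t` that are onto a ball of a forest `F` are those for which `F` extends
the image of `t`. -/
theorem RootedGraph.isBallEmbedding_iff {V : Type} {F : SimpleGraph V}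
    (hF : F.IsAcyclic) {o : V} {t : RootedGraph} [Fintype t.V] {h : ℕ} {ψ : t.V ↪ V}
    (hψ : ψ t.root = o) :
    t.IsBallEmbedding ⟨V, F, o⟩ h ψ ↔
      (t.graph.map ψ).IsForestExtension (Finset.univ.map ψ)
        ((Finset.univ.filter fun x => t.depth x < h).map ψ) F := by
  have hmap : ∀ x y, (t.graph.map ψ).Adj (ψ x) (ψ y) ↔ t.graph.Adj x y :=
    fun x y => SimpleGraph.map_adj_apply
  have hmem : ∀ w, w ∈ Finset.univ.map ψ ↔ w ∈ Set.range ψ := fun w => by simp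
  constructor
  · intro hE
    refine ⟨hF, fun x hx y hy => ?_, fun x hx y hy hxy => ?_⟩
    · obtain ⟨x, rfl⟩ := (hmem _).1 hx
      obtain ⟨y, rfl⟩ := (hmem _).1 hy
      rw [hmap]
      exact hE.adj_iff x y
    · obtain ⟨x, hx', rfl⟩ := Finset.mem_map.1 hx
      exact hy ((hmem _).2 (hE.mem_range x (Finset.mem_filter.1 hx').2 y hxy))
  · intro hE
    refine ⟨hψ, fun x y => ?_, fun x hx w hw => ?_⟩
    · rw [← hmap]
      exact hE.adj_iff ((hmem _).2 ⟨x, rfl⟩) ((hmem _).2 ⟨y, rfl⟩)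
    · by_contra hn
      exact hE.not_adj (Finset.mem_map_of_mem ψ (by simpa using hx)) (fun h => hn ((hmem _).1 h)) hw

open scoped Classical in
theorem RootedGraph.isExploration_map {V : Type} {t : RootedGraph} [Fintype t.V]
    (ht : t.graph.IsTree) (ψ : t.V ↪ V) (h : ℕ) :
    (t.graph.map ψ).IsExploration (Finset.univ.map ψ)
      ((Finset.univ.filter fun x => t.depth x < h).map ψ) ∅ := by
  refine ⟨SimpleGraph.isAcyclic_map ht.isAcyclic ψ, ?_, Finset.empty_subset _,
    Finset.map_subset_map.2 (Finset.filter_subset _ _), by simp, fun x hx _ y hy _ => ?_⟩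
  · rintro _ _ ⟨-, x, y, -, rfl, rfl⟩
    simp
  · obtain ⟨x, -, rfl⟩ := Finset.mem_map.1 hx
    obtain ⟨y, -, rfl⟩ := Finset.mem_map.1 hy
    exact (ht.connected x y).map (SimpleGraph.Embedding.map ψ t.graph).toHom

theorem RootedGraph.sizeLT_add_sizeAt {t : RootedGraph} [Finite t.V] {h : ℕ}
    (hheight : t.HeightLE h) : t.sizeLT h + t.sizeAt h = t.size := by
  classical
  have := Fintype.ofFinite t.V
  rw [sizeLT, sizeAt, size, Nat.card_eq_fintype_card, Nat.card_eq_fintype_card,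
    Nat.card_eq_fintype_card, Fintype.card_subtype, Fintype.card_subtype,
    ← Finset.card_union_of_disjoint, ← Finset.card_univ]
  · congr 1
    ext x
    simpa using (hheight x).lt_or_eq
  · rw [Finset.disjoint_filter]
    exact fun x _ h1 h2 => h1.ne h2

/-! ### Normalising constant and double counting. -/

theorem SpanningForest.weight_eq_prod {V : Type} [Fintype V] {G : SimpleGraph V} {lam : ℝ}
    (hlam : 0 < lam) (F : SpanningForest G) :
    weight lam F = ∏ v, vertexWeight lam (F.1.componentSize v) := by
  classical
  rw [weight, finprod_eq_prod_of_fintype, Nat.card_eq_fintype_card, ← Finset.card_univ,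
    ← Finset.prod_const, ← Finset.prod_mul_distrib,
    ← Finset.prod_fiberwise Finset.univ F.1.connectedComponentMk]
  refine Finset.prod_congr rfl fun c _ => ?_
  have hne : Nat.card c.supp ≠ 0 := by
    have : Nonempty c.supp := c.nonempty_supp.to_subtype
    exact Nat.card_pos.ne'
  rw [← vertexWeight_pow hlam hne]
  have hcard : (Finset.univ.filter fun v => F.1.connectedComponentMk v = c).card =
      Nat.card c.supp := by
    rw [Nat.card_eq_fintype_card, ← Fintype.card_subtype]
    exact Fintype.card_congr (Equiv.refl _)
  rw [← hcard, ← Finset.prod_const]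
  refine Finset.prod_congr rfl fun v hv => ?_
  rw [SimpleGraph.componentSize, (Finset.mem_filter.1 hv).2, hcard]

theorem PMF.toMeasure_real_normalize_ofReal {α : Type*} [Fintype α] [MeasurableSpace α]
    [MeasurableSingletonClass α] (w : α → ℝ) (hw : ∀ a, 0 < w a) (h0 h1) (s : Set α)
    [DecidablePred (· ∈ s)] :
    (PMF.normalize (fun a => ENNReal.ofReal (w a)) h0 h1).toMeasure.real s =
      (∑ a with a ∈ s, w a) / ∑ a, w a := by
  classical
  rw [MeasureTheory.measureReal_def, PMF.toMeasure_apply_fintype, ENNReal.toReal_sum]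
  · rw [Finset.sum_filter, Finset.sum_div]
    refine Finset.sum_congr rfl fun a _ => ?_
    rw [Set.indicator_apply]
    split_ifs
    · rw [PMF.normalize_apply, tsum_fintype, ENNReal.toReal_mul, ENNReal.toReal_inv,
        ENNReal.toReal_ofReal (hw a).le, ← ENNReal.ofReal_sum_of_nonneg fun a _ => (hw a).le,
        ENNReal.toReal_ofReal (Finset.sum_nonneg fun a _ => (hw a).le), div_eq_mul_inv]
    · simp
  · intro a _
    rw [Set.indicator_apply]
    split_ifs
    · exact PMF.apply_ne_top _ _
    · simp

/-- Transpositions of `Fin n` show that the count does not depend on `o`, so it is the number of all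
embeddings divided by `n`. -/
theorem card_embedding_apply_eq {α : Type*} [Finite α] (r : α) {n : ℕ} (o : Fin n) :
    Nat.card {ψ : α ↪ Fin n // ψ r = o} = (n - 1).descFactorial (Nat.card α - 1) := by
  classical
  have := Fintype.ofFinite α
  have hsymm : ∀ o', Nat.card {ψ : α ↪ Fin n // ψ r = o'} = Nat.card {ψ : α ↪ Fin n // ψ r = o} :=
    fun o' => Nat.card_congr
      ((Equiv.embeddingCongr (Equiv.refl α) (Equiv.swap o' o)).subtypeEquiv fun ψ => by
        simp [Equiv.swap_apply_eq_iff])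
  have h1 : Nat.card (α ↪ Fin n) = n * Nat.card {ψ : α ↪ Fin n // ψ r = o} := by
    rw [← Nat.card_congr (Equiv.sigmaFiberEquiv fun ψ : α ↪ Fin n => ψ r), Nat.card_sigma,
      Finset.sum_congr rfl fun o' _ => hsymm o']
    simp
  have hn : 0 < n := o.pos
  have hα : 0 < Nat.card α := Nat.card_pos_iff.2 ⟨⟨r⟩, inferInstance⟩
  rw [Nat.card_eq_fintype_card, Fintype.card_embedding_eq, Fintype.card_fin,
    ← Nat.card_eq_fintype_card (α := α)] at h1
  obtain ⟨n, rfl⟩ := Nat.exists_eq_succ_of_ne_zero hn.ne'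
  obtain ⟨k, hk⟩ := Nat.exists_eq_succ_of_ne_zero hα.ne'
  rw [hk] at h1 ⊢
  exact Nat.eq_of_mul_eq_mul_left hn (h1.symm.trans (Nat.succ_descFactorial_succ n k))

theorem sum_spanningForest_top {V : Type} [Fintype V] [DecidableEq V]
    [Fintype (SpanningForest (⊤ : SimpleGraph V))] (f : SimpleGraph V → ℝ)
    [DecidablePred (SimpleGraph.IsAcyclic (V := V))] :
    ∑ F : SpanningForest (⊤ : SimpleGraph V), f F.1 = ∑ F : SimpleGraph V with F.IsAcyclic, f F := by
  refine Finset.sum_bij (fun F _ => F.1) (fun F _ => by simpa using F.2.2)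
    (fun F _ F' _ h => Subtype.ext h) (fun F hF => ⟨⟨F, le_top, by simpa using hF⟩, Finset.mem_univ _, rfl⟩)
    (fun _ _ => rfl)

/-- Every forest extends the empty exploration, which is closed. -/
theorem sum_weight_top {V : Type} [Fintype V] {lam : ℝ} (hlam : 0 < lam)
    [Fintype (SpanningForest (⊤ : SimpleGraph V))] :
    ∑ F : SpanningForest (⊤ : SimpleGraph V), SpanningForest.weight lam F =
      lam * (Fintype.card V + lam) ^ ((Fintype.card V : ℤ) - 1) := by
  classical
  have h : (⊥ : SimpleGraph V).IsExploration ∅ ∅ ∅ :=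
    ⟨SimpleGraph.isAcyclic_bot, by simp, by simp, by simp, by simp, by simp⟩
  have := h.extensionWeight_eq_of_closed hlam
  rw [Finset.compl_empty, Finset.card_univ] at this
  rw [← this, Finset.sum_congr rfl fun F _ => SpanningForest.weight_eq_prod hlam F,
    sum_spanningForest_top fun F => ∏ v, vertexWeight lam (F.componentSize v), extensionWeight,
    Finset.compl_empty]
  refine Finset.sum_congr ?_ fun _ _ => rfl
  ext F
  simp only [Finset.mem_filter, Finset.mem_univ, true_and]
  exact ⟨fun h => ⟨h, by simp, by simp⟩, fun h => h.isAcyclic⟩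

theorem extensionWeight_map {V : Type} [Fintype V] [DecidableEq V] {lam : ℝ} (hlam : 0 < lam)
    {t : RootedGraph} [Fintype t.V] (ht : t.graph.IsTree) {h : ℕ} (hheight : t.HeightLE h)
    [DecidablePred fun x => t.depth x < h] (ψ : t.V ↪ V) :
    extensionWeight lam (t.graph.map ψ) (Finset.univ.map ψ)
        ((Finset.univ.filter fun x => t.depth x < h).map ψ) ∅ =
      explorationWeight lam (Fintype.card V - t.size) t.size (t.sizeAt h) := by
  classical
  have hex := RootedGraph.isExploration_map ht ψ h
  have hc : (Finset.univ.map ψ).card = t.size := by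
    rw [Finset.card_map, Finset.card_univ, RootedGraph.size, Nat.card_eq_fintype_card]
  have hD : ((Finset.univ.filter fun x => t.depth x < h).map ψ).card = t.sizeLT h := by
    rw [Finset.card_map, RootedGraph.sizeLT, Nat.card_eq_fintype_card, Fintype.card_subtype]
  convert hex.extensionWeight_eq hlam ⟨ψ t.root, by simp⟩ using 2
  · congr!
  · rw [Finset.card_compl, hc]
  · rw [Finset.sdiff_empty, hc]
  · rw [Finset.card_sdiff_of_subset hex.subset_right, hc]
    have := RootedGraph.sizeLT_add_sizeAt hheight
    rw [← hD] at this
    convert (Nat.sub_eq_of_eq_add' this.symm).symm using 3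
    congr!

/-- Weighted pairs of a forest and a ball embedding are summed in both orders; for a fixed embedding
the sum over forests is an extension weight, the same for every embedding. -/
theorem card_aut_mul_sum_weight {V : Type} [Fintype V] {lam : ℝ} (hlam : 0 < lam)
    [Fintype (SpanningForest (⊤ : SimpleGraph V))] (o : V)
    {t : RootedGraph} [Finite t.V] (ht : t.graph.IsTree) {h : ℕ} (hheight : t.HeightLE h)
    [DecidablePred fun F : SpanningForest (⊤ : SimpleGraph V) =>
      ((rootedComponent F.1 o).ball h).shape = t.shape] :
    Nat.card t.Aut * ∑ F : SpanningForest (⊤ : SimpleGraph V) with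
        ((rootedComponent F.1 o).ball h).shape = t.shape, SpanningForest.weight lam F =
      Nat.card {ψ : t.V ↪ V // ψ t.root = o} *
        explorationWeight lam (Fintype.card V - t.size) t.size (t.sizeAt h) := by
  classical
  have := Fintype.ofFinite t.V
  have h1 : ∀ F : SpanningForest (⊤ : SimpleGraph V),
      (if ((rootedComponent F.1 o).ball h).shape = t.shape then
        (Nat.card t.Aut : ℝ) * SpanningForest.weight lam F else 0) =
      ∑ ψ : {ψ : t.V ↪ V // ψ t.root = o}, if t.IsBallEmbedding ⟨V, F.1, o⟩ h ψ.1 then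
        ∏ v, vertexWeight lam (F.1.componentSize v) else 0 := by
    intro F
    have h2 := RootedGraph.card_isBallEmbedding F.1 o ht.connected hheight
    have h3 : Nat.card {ψ : t.V ↪ V // t.IsBallEmbedding ⟨V, F.1, o⟩ h ψ} =
        (Finset.univ.filter fun ψ : {ψ : t.V ↪ V // ψ t.root = o} =>
          t.IsBallEmbedding ⟨V, F.1, o⟩ h ψ.1).card := by
      rw [← Fintype.card_subtype, ← Nat.card_eq_fintype_card]
      exact Nat.card_congr ⟨fun ψ => ⟨⟨ψ.1, ψ.2.map_root⟩, ψ.2⟩, fun ψ => ⟨ψ.1.1, ψ.2⟩,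
        fun _ => rfl, fun _ => rfl⟩
    rw [← Finset.sum_filter, Finset.sum_const, ← h3, h2, nsmul_eq_mul,
      SpanningForest.weight_eq_prod hlam]
    split_ifs <;> simp
  rw [Finset.mul_sum, Finset.sum_filter, Finset.sum_congr rfl fun F _ => h1 F, Finset.sum_comm]
  have h4 : ∀ ψ : {ψ : t.V ↪ V // ψ t.root = o},
      (∑ F : SpanningForest (⊤ : SimpleGraph V), if t.IsBallEmbedding ⟨V, F.1, o⟩ h ψ.1 then
        ∏ v, vertexWeight lam (F.1.componentSize v) else 0) =
      explorationWeight lam (Fintype.card V - t.size) t.size (t.sizeAt h) := by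
    intro ψ
    rw [← extensionWeight_map hlam ht hheight ψ.1, extensionWeight, Finset.compl_empty,
      sum_spanningForest_top fun F => if t.IsBallEmbedding ⟨V, F, o⟩ h ψ.1 then
        ∏ v, vertexWeight lam (F.componentSize v) else 0, ← Finset.sum_filter, Finset.filter_filter]
    refine Finset.sum_congr ?_ fun _ _ => rfl
    ext F
    simp only [Finset.mem_filter, Finset.mem_univ, true_and]
    constructor
    · rintro ⟨hF, hE⟩
      convert (RootedGraph.isBallEmbedding_iff hF ψ.2).1 hE
    · intro hE
      refine ⟨hE.isAcyclic, (RootedGraph.isBallEmbedding_iff hE.isAcyclic ψ.2).2 ?_⟩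
      convert hE
  rw [Finset.sum_congr rfl fun ψ _ => h4 ψ, Finset.sum_const, nsmul_eq_mul, Finset.card_univ,
    Nat.card_eq_fintype_card]

/-! ### The probability for fixed `n`. -/

theorem ballShapeProb_eq_explorationWeight {n : ℕ} (o : Fin n) {lam : ℝ} (hlam : 0 < lam)
    {t : RootedGraph} [Finite t.V] (ht : t.graph.IsTree) {h : ℕ} (hheight : t.HeightLE h) :
    ballShapeProb n o lam hlam h t =
      ((n - 1).descFactorial (t.size - 1) : ℝ) / Nat.card t.Aut *
        explorationWeight lam (n - t.size) t.size (t.sizeAt h) /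
          (lam * (n + lam) ^ ((n : ℤ) - 1)) := by
  classical
  have := Fintype.ofFinite (SpanningForest (⊤ : SimpleGraph (Fin n)))
  have h1 := card_aut_mul_sum_weight hlam o ht hheight
  have hA : (Nat.card t.Aut : ℝ) ≠ 0 := by
    have : Finite t.Aut := Finite.of_injective (fun φ : t.Aut => (φ.1 : t.V → t.V))
      fun φ φ' h => Subtype.ext (RelIso.ext (congrFun h))
    have : Nonempty t.Aut := ⟨⟨SimpleGraph.Iso.refl, rfl⟩⟩
    exact_mod_cast Nat.card_pos.ne'
  rw [card_embedding_apply_eq, Fintype.card_fin, ← RootedGraph.size] at h1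
  have : MeasurableSingletonClass (SpanningForest (⊤ : SimpleGraph (Fin n))) := ⟨fun _ => trivial⟩
  rw [ballShapeProb, massiveSpanningForest, PMF.toMeasure_real_normalize_ofReal _
    (SpanningForest.weight_pos hlam), sum_weight_top hlam, Fintype.card_fin]
  congr 1
  rw [div_mul_eq_mul_div, eq_div_iff hA, ← h1, mul_comm]
  rfl

theorem ballShapeProb_eq {n : ℕ} (o : Fin n) {lam : ℝ} (hlam : 0 < lam)
    {t : RootedGraph} [Finite t.V] (ht : t.graph.IsTree) {h : ℕ} (hheight : t.HeightLE h)
    (hn : t.size ≤ n) :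
    ballShapeProb n o lam hlam h t =
      1 / (Nat.card t.Aut : ℝ) *
        (((n - 1).factorial : ℝ) / ((n - t.size).factorial : ℝ)) *
        (1 / ((n : ℝ) + lam) ^ t.size) *
        ((n : ℝ) * t.sizeAt h + lam * t.size) *
        (1 - (t.sizeLT h : ℝ) / ((n : ℝ) + lam)) ^ ((n : ℤ) - (t.size : ℤ) - 1) := by
  have hk : 0 < t.size := Nat.card_pos_iff.2 ⟨⟨t.root⟩, inferInstance⟩
  have hsum : (t.sizeLT h : ℝ) + t.sizeAt h = t.size := by
    exact_mod_cast RootedGraph.sizeLT_add_sizeAt hheight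
  have hx : (n : ℝ) + lam ≠ 0 := by positivity
  -- As `|t_{<h}| + |t_h| = |t|`, the numerator is the base of `explorationWeight` at `n - |t|` and
  -- `|t_h|`.
  have e1 : 1 - (t.sizeLT h : ℝ) / (n + lam) = (n - t.size + t.sizeAt h + lam) / (n + lam) := by
    rw [← hsum]
    field_simp
    ring
  have e2 : ((n - 1).descFactorial (t.size - 1) : ℝ) =
      ((n - 1).factorial : ℝ) / ((n - t.size).factorial : ℝ) := by
    rw [Nat.descFactorial_eq_div (by omega), Nat.cast_div (Nat.factorial_dvd_factorial (by omega))
      (by positivity), show n - 1 - (t.size - 1) = n - t.size by omega]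
  rw [ballShapeProb_eq_explorationWeight o hlam ht hheight, e1, e2, explorationWeight,
    Nat.cast_sub hn, Nat.cast_sub hn, div_zpow,
    show (n : ℤ) - 1 = ((n : ℤ) - t.size - 1) + t.size by ring, zpow_add₀ hx, zpow_natCast]
  field_simp
  ring

theorem ballShapeProb_eq_zero {n : ℕ} (o : Fin n) {lam : ℝ} (hlam : 0 < lam)
    {t : RootedGraph} [Finite t.V] (ht : t.graph.IsTree) {h : ℕ} (hheight : t.HeightLE h)
    (hn : n < t.size) : ballShapeProb n o lam hlam h t = 0 := by
  have : 0 < n := o.pos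
  rw [ballShapeProb_eq_explorationWeight o hlam ht hheight,
    Nat.descFactorial_eq_zero_iff_lt.2 (by omega)]
  simp

/-! ### Asymptotics. -/

theorem tendsto_pred_descFactorial_pred_div_pow {k : ℕ} (hk : 0 < k) :
    Tendsto (fun n : ℕ => ((n - 1).descFactorial (k - 1) : ℝ) / (n : ℝ) ^ (k - 1)) atTop (𝓝 1) := by
  have h := (isEquivalent_iff_tendsto_one (by
    filter_upwards [eventually_ge_atTop 1] with n hn
    positivity)).1 (isEquivalent_descFactorial k)
  refine h.congr' ?_
  filter_upwards [eventually_ge_atTop 1] with n hn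
  obtain ⟨n, rfl⟩ := Nat.exists_eq_add_of_le' hn
  obtain ⟨k, rfl⟩ := Nat.exists_eq_add_of_le' hk
  simp only [Pi.div_apply, Nat.succ_descFactorial_succ, Nat.add_sub_cancel, pow_succ]
  push_cast
  have : (n : ℝ) + 1 ≠ 0 := by positivity
  field_simp

/-- The limit of the explicit formula, in terms of the limit of `n / (n + lam n)`. -/
theorem tendsto_ballShape_formula {k m j : ℕ} (hk : 0 < k) (hj : j ≤ k) (A : ℝ) {lam : ℕ → ℝ}
    (hlam : ∀ n, 0 < lam n) {σ : ℝ}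
    (hσ : Tendsto (fun n : ℕ => (n : ℝ) / (n + lam n)) atTop (𝓝 σ)) :
    Tendsto (fun n : ℕ => 1 / A * (((n - 1).factorial : ℝ) / ((n - k).factorial : ℝ)) *
        (1 / ((n : ℝ) + lam n) ^ k) * ((n : ℝ) * m + lam n * k) *
        (1 - (j : ℝ) / ((n : ℝ) + lam n)) ^ ((n : ℤ) - (k : ℤ) - 1)) atTop
      (𝓝 (1 / A * (σ ^ (k - 1) * (m * σ + k * (1 - σ)) * Real.exp (-(j * σ))))) := by
  set s : ℕ → ℝ := fun n => (n : ℝ) / (n + lam n) with hs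
  have h1 : Tendsto (fun n : ℕ => (1 + -(j : ℝ) / (n + lam n)) ^ n) atTop
      (𝓝 (Real.exp (-(j * σ)))) := by
    refine Real.tendsto_one_add_pow_exp_of_tendsto ((hσ.const_mul (j : ℝ)).neg.congr fun n => ?_)
    ring
  -- The true exponent is `n - (k+1)`; as the base tends to `1`, the `k+1` missing factors do not
  -- affect the limit.
  have h2 : Tendsto (fun n : ℕ => 1 + -(j : ℝ) / (n + lam n)) atTop (𝓝 1) := by
    have h3 : Tendsto (fun n : ℕ => (n : ℝ) + lam n) atTop atTop :=
      tendsto_atTop_mono (fun n => by linarith [hlam n]) tendsto_natCast_atTop_atTop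
    simpa using (h3.const_div_atTop (-(j : ℝ))).const_add 1
  have h4 := ((tendsto_pred_descFactorial_pred_div_pow hk).mul
    (((hσ.pow (k - 1)).mul ((hσ.const_mul (m : ℝ)).add ((hσ.const_sub 1).const_mul (k : ℝ)))).mul
      (h1.mul ((h2.pow (k + 1)).inv₀ (by simp))))).const_mul (1 / A)
  simp only [one_pow, inv_one, mul_one, one_mul] at h4
  refine h4.congr' ?_
  filter_upwards [eventually_ge_atTop k] with n hn
  have hn0 : (n : ℝ) ≠ 0 := by
    have := hk.trans_le hn
    positivity
  have hx : 0 < (n : ℝ) + lam n := by linarith [hlam n, (n.cast_nonneg : (0 : ℝ) ≤ n)]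
  have hy : 1 - (j : ℝ) / (n + lam n) ≠ 0 := by
    have : (j : ℝ) < n + lam n := by
      have : (j : ℝ) ≤ n := by exact_mod_cast hj.trans hn
      linarith [hlam n]
    exact (sub_pos.2 ((div_lt_one hx).2 this)).ne'
  have e1 : ((n - 1).descFactorial (k - 1) : ℝ) =
      ((n - 1).factorial : ℝ) / ((n - k).factorial : ℝ) := by
    rw [Nat.descFactorial_eq_div (by omega), Nat.cast_div (Nat.factorial_dvd_factorial (by omega))
      (by positivity), show n - 1 - (k - 1) = n - k by omega]
  rw [← e1, neg_div, ← sub_eq_add_neg,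
    show (n : ℤ) - k - 1 = (n : ℤ) - (k + 1 : ℕ) by push_cast; ring, zpow_sub₀ hy, zpow_natCast,
    zpow_natCast]
  generalize 1 - (j : ℝ) / (n + lam n) = y at hy
  obtain ⟨k, rfl⟩ := Nat.exists_eq_add_of_le' hk
  simp only [hs, Nat.add_sub_cancel, div_pow]
  have hx' := hx.ne'
  field_simp
  ring

theorem tendsto_ballShapeProb {t : RootedGraph} [Finite t.V] (ht : t.graph.IsTree) {h : ℕ}
    (hheight : t.HeightLE h) (o : (n : ℕ+) → Fin n) {lam : ℕ+ → ℝ} (hlam : ∀ n, 0 < lam n) {σ : ℝ}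
    (hσ : Tendsto (fun n : ℕ+ => (n : ℝ) / (n + lam n)) atTop (𝓝 σ)) :
    Tendsto (fun n : ℕ+ => ballShapeProb n (o n) (lam n) (hlam n) h t) atTop
      (𝓝 (1 / Nat.card t.Aut * (σ ^ (t.size - 1) * (t.sizeAt h * σ + t.size * (1 - σ)) *
        Real.exp (-(t.sizeLT h * σ))))) := by
  have hk : 0 < t.size := Nat.card_pos_iff.2 ⟨⟨t.root⟩, inferInstance⟩
  have hj : t.sizeLT h ≤ t.size := by
    have := RootedGraph.sizeLT_add_sizeAt hheight
    omega
  -- The sequence is extended to `ℕ` by `toPNat'`; its value at `0` plays no role in the limit.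
  have hσ' : Tendsto (fun n : ℕ => (n : ℝ) / (n + lam n.toPNat')) atTop (𝓝 σ) := by
    rw [← PNat.tendsto_comp_val_iff]
    simpa only [PNat.coe_toPNat'] using hσ
  have h1 := tendsto_ballShape_formula (m := t.sizeAt h) hk hj (Nat.card t.Aut : ℝ)
    (lam := fun n => lam n.toPNat') (fun n => hlam _) hσ'
  rw [← PNat.tendsto_comp_val_iff] at h1
  refine h1.congr' ?_
  filter_upwards [eventually_ge_atTop (⟨t.size, hk⟩ : ℕ+)] with n hn
  simp only [PNat.coe_toPNat']
  exact (ballShapeProb_eq (o n) (hlam n) ht hheight hn).symm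

theorem RootedGraph.card_aut_of_size_eq_one {t : RootedGraph} (ht : t.size = 1) :
    Nat.card t.Aut = 1 := by
  have : Subsingleton t.V := (Nat.card_eq_one_iff_unique.1 ht).1
  exact Nat.card_eq_one_iff_unique.2
    ⟨⟨fun φ φ' => Subtype.ext (RelIso.ext fun x => Subsingleton.elim _ _)⟩,
      ⟨⟨SimpleGraph.Iso.refl, rfl⟩⟩⟩

theorem mainTheorem2 (h : ℕ) (t : RootedGraph) (hfin : Finite t.V) (htree : t.graph.IsTree)
    (hheight : t.HeightLE h) :
    (∀ (n : ℕ) (o : Fin n) (lam : ℝ) (hlam : 0 < lam),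
      (t.size ≤ n →
        ballShapeProb n o lam hlam h t =
          1 / (Nat.card t.Aut : ℝ) *
            (((n - 1).factorial : ℝ) / ((n - t.size).factorial : ℝ)) *
            (1 / ((n : ℝ) + lam) ^ t.size) *
            ((n : ℝ) * t.sizeAt h + lam * t.size) *
            (1 - (t.sizeLT h : ℝ) / ((n : ℝ) + lam)) ^ ((n : ℤ) - (t.size : ℤ) - 1)) ∧
      (n < t.size → ballShapeProb n o lam hlam h t = 0)) ∧
    (∀ (o : (n : ℕ+) → Fin n) (lam : ℕ+ → ℝ) (hlam : ∀ n, 0 < lam n),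
      (lam =o[atTop] (fun n : ℕ+ => (n : ℝ)) →
        Tendsto (fun n : ℕ+ => ballShapeProb n (o n) (lam n) (hlam n) h t) atTop
          (𝓝 ((t.sizeAt h : ℝ) / (Nat.card t.Aut : ℝ) * Real.exp (-(t.sizeLT h : ℝ))))) ∧
      (∀ α : ℝ, 0 < α → lam ~[atTop] (fun n : ℕ+ => α * (n : ℝ)) →
        Tendsto (fun n : ℕ+ => ballShapeProb n (o n) (lam n) (hlam n) h t) atTop
          (𝓝 (((t.sizeAt h : ℝ) + α * t.size) / (Nat.card t.Aut : ℝ) *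
            (1 / (1 + α) ^ t.size) * Real.exp (-((t.sizeLT h : ℝ) / (1 + α)))))) ∧
      (Tendsto (fun n : ℕ+ => lam n / (n : ℝ)) atTop atTop →
        Tendsto (fun n : ℕ+ => ballShapeProb n (o n) (lam n) (hlam n) h t) atTop
          (𝓝 (if t.size = 1 then 1 else 0)))) := by
  -- Each regime prescribes the limit of `λ_n / n`, and this identity converts it into `σ`.
  have hratio : ∀ (lam : ℕ+ → ℝ), (∀ n, 0 < lam n) → ∀ n : ℕ+,
      (1 + lam n / n)⁻¹ = (n : ℝ) / (n + lam n) := fun lam hlam n => by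
    have h0 : (n : ℝ) ≠ 0 := by positivity
    have h1 := hlam n
    field_simp
  refine ⟨fun n o lam hlam => ⟨ballShapeProb_eq o hlam htree hheight,
    ballShapeProb_eq_zero o hlam htree hheight⟩, fun o lam hlam => ⟨fun hl => ?_, fun α hα hl => ?_,
    fun hl => ?_⟩⟩
  · have hσ : Tendsto (fun n : ℕ+ => (n : ℝ) / (n + lam n)) atTop (𝓝 1) := by
      have := (hl.tendsto_div_nhds_zero.const_add 1).inv₀ (by simp)
      rw [add_zero, inv_one] at this
      exact this.congr (hratio lam hlam)
    convert tendsto_ballShapeProb htree hheight o hlam hσ using 2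
    simp
    ring
  · have hα' : 1 + α ≠ 0 := by positivity
    have hσ : Tendsto (fun n : ℕ+ => (n : ℝ) / (n + lam n)) atTop (𝓝 (1 + α)⁻¹) := by
      have h1 := (isEquivalent_iff_tendsto_one (Eventually.of_forall fun n : ℕ+ => by
        positivity)).1 hl
      have h2 : Tendsto (fun n : ℕ+ => lam n / n) atTop (𝓝 α) := by
        have := h1.const_mul α
        rw [mul_one] at this
        refine this.congr fun n => ?_
        simp only [Pi.div_apply]
        field_simp
      exact ((h2.const_add 1).inv₀ hα').congr (hratio lam hlam)
    convert tendsto_ballShapeProb htree hheight o hlam hσ using 2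
    have hk : 0 < t.size := Nat.card_pos_iff.2 ⟨⟨t.root⟩, hfin⟩
    rw [← div_eq_mul_inv (t.sizeLT h : ℝ)]
    obtain ⟨k, hk⟩ := Nat.exists_eq_add_of_le' hk
    rw [hk, Nat.add_sub_cancel, inv_pow]
    field_simp
    push_cast
    ring
  · have hσ : Tendsto (fun n : ℕ+ => (n : ℝ) / (n + lam n)) atTop (𝓝 0) :=
      (tendsto_atTop_add_const_left _ 1 hl).inv_tendsto_atTop.congr (hratio lam hlam)
    convert tendsto_ballShapeProb htree hheight o hlam hσ using 2
    have hk : 0 < t.size := Nat.card_pos_iff.2 ⟨⟨t.root⟩, hfin⟩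
    -- At `σ = 0` the factor `σ^(|t|-1)` kills the limit unless `|t| = 1`, where `0^0 = 1`.
    split_ifs with h1
    · simp [h1, t.card_aut_of_size_eq_one h1]
    · rw [zero_pow (by omega)]
      simp
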